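/- Let $\Gamma$ be a countable discrete group that is $C^*$-simple, i.e. its reduced $C^*$-algebra $C^*_r(\Gamma)\subseteq B(\ell^2(\Gamma))$, generated by the left regular representation $\lambda$, has no closed two-sided ideals other than $0$ and itself. Let $A$ be a unital $\Gamma$-$C^*$-algebra, i.e. a unital $C^*$-algebra on which $\Gamma$ acts by $*$-automorphisms. For a probability measure $\mu$ on $\Gamma$, a state $\tau$ on a unital $\Gamma$-$C^*$-algebra $D$ is called $\mu$-stationary if $\sum_{s\in\Gamma}\mu(s)\,\tau(s^{-1}a)=\tau(a)$ for all $a\in D$. The measure $\mu$ is called $C^*$-simple if the canonical trace $\tau_0$ (given by $\tau_0(\lambda_e)=1$ and $\tau_0(\lambda_s)=0$ for $s\neq e$) is the unique $\mu$-stationary state on $C^*_r(\Gamma)$, where $\Gamma$ acts on $C^*_r(\Gamma)$ by the inner automorphisms $x\mapsto\lambda_s x\lambda_s^*$. Let $\pi:A\to B(H)$ be any faithful unital $*$-representation on a Hilbert space. The reduced crossed product $\Gamma\ltimes_r A$ is the $C^*$-subalgebra of $B(\ell^2(\Gamma,H))$ generated by the unitaries $(\tilde\lambda_s\xi)(t)=\xi(s^{-1}t)$,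 $s\in\Gamma$, and the operators $(\sigma(a)\xi)(t)=\pi(t^{-1}a)(\xi(t))$, $a\in A$; the group $\Gamma$ acts on it by the inner automorphisms $x\mapsto\tilde\lambda_s x\tilde\lambda_s^*$. Suppose that there is a $C^*$-simple probability measure $\mu$ on $\Gamma$ such that every $\mu$-stationary state $\tau$ on $A$ is faithful (i.e. $\tau(a^*a)=0$ implies $a=0$). Then every $\Gamma$-invariant $C^*$-subalgebra $B$ of $\Gamma\ltimes_r A$ that contains its unit is $\Gamma$-simple, i.e. $B$ has no closed two-sided $\Gamma$-invariant ideals other than $0$ and $B$. -/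

import Mathlib

open scoped ENNReal ComplexOrder InnerProductSpace

noncomputable section

namespace GammaCStar

/-! ### Actions by `*`-automorphisms, states, simplicity

An action of a group `Γ` on a unital `*`-algebra `A` is a homomorphism `Γ →* (A ≃⋆ₐ[ℂ] A)`. -/

section Actions

variable {Γ A : Type*} [Group Γ] [Ring A] [StarRing A] [Algebra ℂ A] [StarModule ℂ A]

/-- The restriction of an action to an invariant unital `*`-subalgebra. -/
def restrictAction (α : Γ →* (A ≃⋆ₐ[ℂ] A)) (B : StarSubalgebra ℂ A)
    (hB : ∀ s : Γ, ∀ x ∈ B, α s x ∈ B) : Γ →* (B ≃⋆ₐ[ℂ] B) where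
  toFun s :=
    { toFun := fun x => ⟨α s x, hB s x x.2⟩
      invFun := fun x => ⟨α s⁻¹ x, hB s⁻¹ x x.2⟩
      left_inv := fun x => Subtype.ext <| by
        change α s⁻¹ (α s x) = x
        rw [← StarAlgEquiv.mul_apply, ← map_mul, inv_mul_cancel, map_one, StarAlgEquiv.one_apply]
      right_inv := fun x => Subtype.ext <| by
        change α s (α s⁻¹ x) = x
        rw [← StarAlgEquiv.mul_apply, ← map_mul, mul_inv_cancel, map_one, StarAlgEquiv.one_apply]
      map_mul' := fun x y => Subtype.ext (map_mul (α s) (x : A) y)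
      map_add' := fun x y => Subtype.ext (map_add (α s) (x : A) y)
      map_star' := fun x => Subtype.ext (map_star (α s) (x : A))
      map_smul' := fun c x => Subtype.ext (map_smul (α s) c (x : A)) }
  map_one' := by
    ext x
    change α 1 x = x
    rw [map_one, StarAlgEquiv.one_apply]
  map_mul' s t := by
    ext x
    change α (s * t) x = α s (α t x)
    rw [map_mul, StarAlgEquiv.mul_apply]

@[simp]
theorem coe_restrictAction (α : Γ →* (A ≃⋆ₐ[ℂ] A)) (B : StarSubalgebra ℂ A)
    (hB : ∀ s : Γ, ∀ x ∈ B, α s x ∈ B) (s : Γ) (x : B) :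
    (restrictAction α B hB s x : A) = α s x := rfl

/-- The action by inner automorphisms `x ↦ u s * x * (u s)⋆` attached to a unitary
representation `u` of `Γ` in `A`. -/
def innerAction (u : Γ →* unitary A) : Γ →* (A ≃⋆ₐ[ℂ] A) :=
  (Unitary.conjStarAlgAut ℂ A).comp u

@[simp]
theorem innerAction_apply {Γ A : Type*} [Group Γ] [Ring A] [StarRing A] [Algebra ℂ A]
    (u : Γ →* unitary A) (s : Γ) (x : A) :
    innerAction u s x = (u s : A) * x * star (u s : A) := rfl

/-- A state: a linear functional that is positive and takes the value `1` at the unit. -/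
structure IsState (τ : A →ₗ[ℂ] ℂ) : Prop where
  nonneg : ∀ a : A, 0 ≤ τ (star a * a)
  map_one : τ 1 = 1

/-- Faithfulness: `τ` vanishes at no nonzero positive element `a⋆ a`. -/
def IsFaithful (τ : A →ₗ[ℂ] ℂ) : Prop :=
  ∀ a : A, τ (star a * a) = 0 → a = 0

/-- `μ`-stationarity: `∑ₛ μ(s) (s τ) = τ`, where `(s τ)(a) = τ (s⁻¹ a)`. -/
def IsStationary (α : Γ →* (A ≃⋆ₐ[ℂ] A)) (μ : PMF Γ) (τ : A →ₗ[ℂ] ℂ) : Prop :=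
  ∀ a : A, HasSum (fun s : Γ => ((μ s).toReal : ℂ) * τ (α s⁻¹ a)) (τ a)

/-- `Γ`-simplicity: the only closed two-sided `Γ`-invariant ideals are `0` and the whole
algebra. -/
def IsGammaSimple [TopologicalSpace A] (α : Γ →* (A ≃⋆ₐ[ℂ] A)) : Prop :=
  ∀ I : TwoSidedIdeal A, IsClosed (I : Set A) → (∀ s : Γ, ∀ a ∈ I, α s a ∈ I) → I = ⊥ ∨ I = ⊤

end Actions

/-- The C⋆-algebra generated by a set: the norm closure of the unital `*`-subalgebra that it
generates. -/
def generatedCStar {M : Type*} [CStarAlgebra M] (S : Set M) : StarSubalgebra ℂ M :=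
  (StarAlgebra.adjoin ℂ S).topologicalClosure

theorem subset_generatedCStar {M : Type*} [CStarAlgebra M] (S : Set M) :
    S ⊆ generatedCStar S := fun _ hx =>
  (StarAlgebra.adjoin ℂ S).le_topologicalClosure (StarAlgebra.subset_adjoin ℂ S hx)

theorem innerAction_mem {Γ M : Type*} [Group Γ] [CStarAlgebra M] (u : Γ →* unitary M)
    (B : StarSubalgebra ℂ M) (hu : ∀ s, (u s : M) ∈ B) (s : Γ) (x : M) (hx : x ∈ B) :
    innerAction u s x ∈ B := by
  rw [innerAction_apply]
  exact mul_mem (mul_mem (hu s) hx) (star_mem (hu s))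

/-! ### The Hilbert space `ℓ²(Γ, H)` and the left translation unitaries -/

section L2

/-- The space of square summable `H`-valued functions on `Γ`. -/
abbrev L2 (Γ H : Type*) [NormedAddCommGroup H] : Type _ := lp (fun _ : Γ => H) 2

theorem memlp_two_iff {Γ H : Type*} [NormedAddCommGroup H] {f : Γ → H} : Memℓp f 2 ↔ Summable fun t => ‖f t‖ ^ 2 := by
  rw [memℓp_gen_iff (by norm_num)]
  norm_num

theorem L2.norm_sq {Γ H : Type*} [NormedAddCommGroup H] (ξ : L2 Γ H) : ‖ξ‖ ^ 2 = ∑' t, ‖ξ t‖ ^ 2 := by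
  have h := lp.norm_rpow_eq_tsum (p := 2) (by norm_num) ξ
  norm_num at h
  exact h

theorem L2.summable {Γ H : Type*} [NormedAddCommGroup H] (ξ : L2 Γ H) : Summable fun t => ‖ξ t‖ ^ 2 :=
  memlp_two_iff.1 (lp.memℓp ξ)

variable {Γ H : Type*} [Group Γ] [NormedAddCommGroup H] [InnerProductSpace ℂ H]

/-- The operator `(s ξ)(t) = ξ (s⁻¹ t)` as a linear isometry. -/
def translate (s : Γ) : L2 Γ H →ₗᵢ[ℂ] L2 Γ H where
  toFun ξ := ⟨fun t => ξ (s⁻¹ * t),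
    memlp_two_iff.2 ((Equiv.mulLeft s⁻¹).summable_iff.2 ξ.summable)⟩
  map_add' _ _ := rfl
  map_smul' _ _ := rfl
  norm_map' ξ := by
    refine (sq_eq_sq₀ (norm_nonneg _) (norm_nonneg _)).1 ?_
    rw [L2.norm_sq, L2.norm_sq]
    exact (Equiv.mulLeft s⁻¹).tsum_eq fun t => ‖ξ t‖ ^ 2

variable (Γ H) in
/-- The action of `Γ` on `ℓ²(Γ, H)` by left translation, `(s ξ)(t) = ξ (s⁻¹ t)`. -/
def translateEquiv : Γ →* (L2 Γ H ≃ₗᵢ[ℂ] L2 Γ H) where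
  toFun s :=
    { toLinearEquiv := LinearEquiv.ofLinearMap (translate s).toLinearMap (translate s⁻¹).toLinearMap
        (by
          ext ξ t
          change ξ (s⁻¹⁻¹ * (s⁻¹ * t)) = ξ t
          simp)
        (by
          ext ξ t
          change ξ (s⁻¹ * (s⁻¹⁻¹ * t)) = ξ t
          simp)
      norm_map' := (translate s).norm_map }
  map_one' := by
    ext ξ t
    change ξ (1⁻¹ * t) = ξ t
    simp
  map_mul' s₁ s₂ := by
    ext ξ t
    change ξ ((s₁ * s₂)⁻¹ * t) = ξ (s₂⁻¹ * (s₁⁻¹ * t))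
    simp [mul_assoc]

variable [CompleteSpace H]

variable (Γ H) in
/-- The left translation unitaries of `ℓ²(Γ, H)`; for `H = ℂ` this is the left regular
representation of `Γ`. -/
def leftTranslation : Γ →* unitary (L2 Γ H →L[ℂ] L2 Γ H) :=
  (Unitary.linearIsometryEquiv (𝕜 := ℂ) (H := L2 Γ H)).symm.toMonoidHom.comp (translateEquiv Γ H)

@[simp]
theorem leftTranslation_apply (s : Γ) (ξ : L2 Γ H) (t : Γ) :
    (leftTranslation Γ H s : L2 Γ H →L[ℂ] L2 Γ H) ξ t = ξ (s⁻¹ * t) := rfl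

end L2

/-! ### The reduced group C⋆-algebra -/

section ReducedGroup

variable (Γ : Type*) [Group Γ]

/-- The reduced C⋆-algebra of `Γ`, generated by the left regular representation. -/
def reducedGroupCStar : StarSubalgebra ℂ (L2 Γ ℂ →L[ℂ] L2 Γ ℂ) :=
  generatedCStar (Set.range fun s : Γ => (leftTranslation Γ ℂ s : L2 Γ ℂ →L[ℂ] L2 Γ ℂ))

/-- The action of `Γ` on its reduced C⋆-algebra by the inner automorphisms `x ↦ λₛ x λₛ⋆`. -/
def reducedGroupAction : Γ →* (reducedGroupCStar Γ ≃⋆ₐ[ℂ] reducedGroupCStar Γ) :=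
  restrictAction (innerAction (leftTranslation Γ ℂ)) (reducedGroupCStar Γ)
    (innerAction_mem _ _ fun s => subset_generatedCStar (M := L2 Γ ℂ →L[ℂ] L2 Γ ℂ) _ ⟨s, rfl⟩)

open Classical in
/-- The canonical trace `x ↦ ⟨δₑ, x δₑ⟩` of the reduced C⋆-algebra. -/
def canonicalTrace : reducedGroupCStar Γ →ₗ[ℂ] ℂ where
  toFun x := ⟪(lp.single 2 (1 : Γ) (1 : ℂ) : L2 Γ ℂ),
    (x : L2 Γ ℂ →L[ℂ] L2 Γ ℂ) (lp.single 2 (1 : Γ) (1 : ℂ))⟫_ℂ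
  map_add' x y := by simp
  map_smul' c x := by simp

/-- `Γ` is C⋆-simple if its reduced C⋆-algebra has no closed two-sided ideals besides `0` and
the whole algebra. -/
def IsCStarSimpleGroup : Prop :=
  ∀ I : TwoSidedIdeal (reducedGroupCStar Γ),
    IsClosed (I : Set (reducedGroupCStar Γ)) → I = ⊥ ∨ I = ⊤

variable {Γ}

/-- `μ` is C⋆-simple if the canonical trace is the unique `μ`-stationary state on the reduced
C⋆-algebra. -/
def IsCStarSimpleMeasure (μ : PMF Γ) : Prop :=
  ∀ τ : reducedGroupCStar Γ →ₗ[ℂ] ℂ,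
    (IsState τ ∧ IsStationary (reducedGroupAction Γ) μ τ) ↔ τ = canonicalTrace Γ

end ReducedGroup

/-! ### The reduced crossed product -/

section CrossedProduct

variable {Γ A H : Type*} [Group Γ] [CStarAlgebra A]
  [NormedAddCommGroup H] [InnerProductSpace ℂ H] [CompleteSpace H]

theorem norm_diagonal_le (α : Γ →* (A ≃⋆ₐ[ℂ] A)) (π : A →⋆ₐ[ℂ] (H →L[ℂ] H)) (a : A) (t : Γ)
    (v : H) : ‖π (α t⁻¹ a) v‖ ^ 2 ≤ ‖a‖ ^ 2 * ‖v‖ ^ 2 := by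
  rw [← mul_pow]
  have h : ‖π (α t⁻¹ a)‖ ≤ ‖a‖ :=
    (NonUnitalStarAlgHom.norm_apply_le π _).trans (NonUnitalStarAlgHom.norm_apply_le (α t⁻¹) a)
  gcongr
  exact ((π (α t⁻¹ a)).le_opNorm v).trans (by gcongr)

/-- The operator `(σ(a) ξ)(t) = π (t⁻¹ a) (ξ t)` on `ℓ²(Γ, H)`. -/
def diagonal (α : Γ →* (A ≃⋆ₐ[ℂ] A)) (π : A →⋆ₐ[ℂ] (H →L[ℂ] H)) (a : A) :
    L2 Γ H →L[ℂ] L2 Γ H :=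
  LinearMap.mkContinuous
    { toFun := fun ξ => ⟨fun t => π (α t⁻¹ a) (ξ t), memlp_two_iff.2 <|
        Summable.of_nonneg_of_le (fun _ => by positivity)
          (fun t => norm_diagonal_le α π a t (ξ t)) (ξ.summable.mul_left (‖a‖ ^ 2))⟩
      map_add' := fun ξ η => by
        ext t
        exact map_add (π (α t⁻¹ a)) (ξ t) (η t)
      map_smul' := fun c ξ => by
        ext t
        exact map_smul (π (α t⁻¹ a)) c (ξ t) }
    ‖a‖ fun ξ => by
      refine (sq_le_sq₀ (norm_nonneg _) (by positivity)).1 ?_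
      rw [mul_pow, L2.norm_sq, L2.norm_sq, ← tsum_mul_left]
      exact Summable.tsum_le_tsum (fun t => norm_diagonal_le α π a t (ξ t)) (L2.summable _)
        (ξ.summable.mul_left (‖a‖ ^ 2))

@[simp]
theorem diagonal_apply (α : Γ →* (A ≃⋆ₐ[ℂ] A)) (π : A →⋆ₐ[ℂ] (H →L[ℂ] H)) (a : A)
    (ξ : L2 Γ H) (t : Γ) : diagonal α π a ξ t = π (α t⁻¹ a) (ξ t) := rfl

/-- The reduced crossed product of `A` by the action `α` of `Γ`, built on the representation
`π` of `A`: the C⋆-algebra generated by the left translation unitaries and the operators `σ(a)`.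
It is used for faithful `π` only, and does then not depend on `π` up to isomorphism. -/
def reducedCrossedProduct (α : Γ →* (A ≃⋆ₐ[ℂ] A)) (π : A →⋆ₐ[ℂ] (H →L[ℂ] H)) :
    StarSubalgebra ℂ (L2 Γ H →L[ℂ] L2 Γ H) :=
  generatedCStar
    ((Set.range fun s : Γ => (leftTranslation Γ H s : L2 Γ H →L[ℂ] L2 Γ H)) ∪
      Set.range (diagonal α π))

/-- The action of `Γ` on the reduced crossed product by the inner automorphisms attached to
the left translation unitaries. -/
def crossedProductAction (α : Γ →* (A ≃⋆ₐ[ℂ] A)) (π : A →⋆ₐ[ℂ] (H →L[ℂ] H)) :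
    Γ →* (reducedCrossedProduct α π ≃⋆ₐ[ℂ] reducedCrossedProduct α π) :=
  restrictAction (innerAction (leftTranslation Γ H)) (reducedCrossedProduct α π)
    (innerAction_mem _ _ fun s =>
      subset_generatedCStar (M := L2 Γ H →L[ℂ] L2 Γ H) _ (Or.inl ⟨s, rfl⟩))

end CrossedProduct

end GammaCStar

end

/-!
Everything takes place in `M = B(ℓ²(Γ, H))`, on which `Γ` acts by conjugation with the left
translations. The measure `μ` gives the Markov operator `T x = ∑ₛ μ(s) s⁻¹x` on `M`, and a
functional is stationary when it is `T`-invariant.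

Let `I` be a proper closed invariant ideal of `B`. By the Neumann series the unit has distance `1`
from `I`, so a Hahn–Banach functional of norm `1` takes the value `1` at the unit and vanishes
on `I`. The ideal is `T`-invariant, so a limit point `φ` of the Cesàro means of this functional
still vanishes on `I`, and it is a stationary state of `M`
(`exists_invariant_functional_vanishing`, `apply_star_mul_self_nonneg`). Averaging on all of `M`
makes a separate extension of stationary states from `B` unnecessary.

Next, `φ(σ(a) λₛ) = 0` for `s ≠ 1` (`apply_diagonal_mul_leftTranslation_eq_zero`). On the reduced
group C⋆-algebra, uniqueness of the stationary state forces the Cesàro means `Aₙ λₛ` to come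
arbitrarily close to `0` in norm (`exists_norm_cesaro_lt`): otherwise vector states that detect
`Aₙ λₛ` would average to a stationary state other than the trace. The means have nonnegative
coefficients, and the pointwise estimate `‖(σ(a) λₛ ξ)(t)‖ ≤ ‖a‖ (λₛ ‖ξ‖)(t)` is preserved by
averaging (`IsDominated.cesaro`), whence `|φ(σ(a) λₛ)| ≤ ‖Aₙ (σ(a) λₛ)‖ ≤ ‖a‖ ‖Aₙ λₛ‖`.

So on the reduced crossed product `φ` is the composition of the canonical expectation with the
stationary state `φ ∘ σ` of `A` (`exists_coefficient`). The latter is faithful by hypothesis, and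
so is the expectation, hence `φ` is faithful on the reduced crossed product
(`eq_zero_of_apply_star_mul_self_eq_zero`). As `φ` vanishes on `I`, the ideal is zero.
-/

noncomputable section

namespace GammaCStar

/-! ### Invariant functionals by Cesàro averaging -/

section Cesaro

open Filter Topology

variable {E : Type*} [NormedAddCommGroup E] [NormedSpace ℂ E]

/-- Banach–Alaoglu for sequences: a bounded sequence of functionals has a pointwise limit along
an ultrafilter. -/
theorem exists_tendsto_hyperfilter (f : ℕ → E →L[ℂ] ℂ) (hf : ∀ n, ‖f n‖ ≤ 1) :
    ∃ g : E →L[ℂ] ℂ, ‖g‖ ≤ 1 ∧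
      ∀ x, Tendsto (fun n => f n x) (hyperfilter ℕ : Filter ℕ) (𝓝 (g x)) := by
  let F : ℕ → WeakDual ℂ E := fun n => StrongDual.toWeakDual (f n)
  obtain ⟨g, hg, hlim⟩ := (WeakDual.isCompact_closedBall (𝕜 := ℂ) (0 : StrongDual ℂ E)
    1).ultrafilter_le_nhds ((hyperfilter ℕ).map F) (by
      rw [le_principal_iff]
      refine mem_map.2 (univ_mem' fun n => ?_)
      simpa [F] using hf n)
  refine ⟨WeakDual.toStrongDual g, by simpa using hg, fun x => ?_⟩
  exact ((WeakDual.eval_continuous x).tendsto g).comp hlim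

/-- The Cesàro mean `(n + 1)⁻¹ ∑_{k ≤ n} Tᵏ`. -/
def cesaro (T : E →L[ℂ] E) (n : ℕ) : E →L[ℂ] E :=
  ((n : ℂ) + 1)⁻¹ • ∑ k ∈ Finset.range (n + 1), T ^ k

theorem cesaro_apply (T : E →L[ℂ] E) (n : ℕ) (x : E) :
    cesaro T n x = ((n : ℂ) + 1)⁻¹ • ∑ k ∈ Finset.range (n + 1), (T ^ k) x := by
  simp [cesaro]

theorem cesaro_apply_of_fixed {T : E →L[ℂ] E} {x : E} (hx : T x = x) (n : ℕ) :
    cesaro T n x = x := by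
  have hk : ∀ k, (T ^ k) x = x := fun k => by
    induction k with
    | zero => rfl
    | succ k ih => rw [pow_succ, mul_apply_eq_comp, hx, ih]
  have : (n : ℂ) + 1 ≠ 0 := by exact_mod_cast n.succ_ne_zero
  rw [cesaro_apply, Finset.sum_congr rfl fun k _ => hk k, Finset.sum_const, Finset.card_range,
    ← Nat.cast_smul_eq_nsmul ℂ, smul_smul]
  push_cast
  rw [inv_mul_cancel₀ this, one_smul]

theorem cesaro_mem {T : E →L[ℂ] E} {J : Submodule ℂ E} (hJ : ∀ x ∈ J, T x ∈ J) (n : ℕ) {x : E}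
    (hx : x ∈ J) : cesaro T n x ∈ J := by
  have hk : ∀ k, (T ^ k) x ∈ J := fun k => by
    induction k with
    | zero => exact hx
    | succ k ih => rw [pow_succ', mul_apply_eq_comp]; exact hJ _ ih
  rw [cesaro_apply]
  exact J.smul_mem _ (J.sum_mem fun k _ => hk k)

theorem norm_inv_natCast_add_one (n : ℕ) : ‖((n : ℂ) + 1)⁻¹‖ = ((n : ℝ) + 1)⁻¹ := by
  rw [norm_inv]
  norm_cast

theorem norm_pow_apply_le {T : E →L[ℂ] E} (hT : ‖T‖ ≤ 1) (k : ℕ) (x : E) :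
    ‖(T ^ k) x‖ ≤ ‖x‖ := by
  induction k with
  | zero => rfl
  | succ k ih =>
    rw [pow_succ', mul_apply_eq_comp]
    exact (T.le_of_opNorm_le hT _).trans (by rwa [one_mul])

theorem norm_cesaro_apply_le {T : E →L[ℂ] E} (hT : ‖T‖ ≤ 1) (n : ℕ) (x : E) :
    ‖cesaro T n x‖ ≤ ‖x‖ := by
  rw [cesaro_apply, norm_smul, norm_inv_natCast_add_one, inv_mul_le_iff₀ (by positivity)]
  refine (norm_sum_le_of_le _ fun k _ => norm_pow_apply_le hT k x).trans ?_
  simp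

theorem norm_cesaro_le {T : E →L[ℂ] E} (hT : ‖T‖ ≤ 1) (n : ℕ) : ‖cesaro T n‖ ≤ 1 :=
  ContinuousLinearMap.opNorm_le_bound _ zero_le_one fun x => by
    rw [one_mul]; exact norm_cesaro_apply_le hT n x

theorem norm_cesaro_sub_le {T : E →L[ℂ] E} (hT : ‖T‖ ≤ 1) (n : ℕ) (x : E) :
    ‖cesaro T n (T x - x)‖ ≤ 2 * ‖x‖ / ((n : ℝ) + 1) := by
  have h : ∑ k ∈ Finset.range (n + 1), (T ^ k) (T x - x) = (T ^ (n + 1)) x - x := by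
    have := Finset.sum_range_sub (fun k => (T ^ k) x) (n + 1)
    rw [pow_zero, one_apply_eq_self] at this
    rw [← this]
    refine Finset.sum_congr rfl fun k _ => ?_
    rw [map_sub, pow_succ, mul_apply_eq_comp]
  rw [cesaro_apply, h, norm_smul, norm_inv_natCast_add_one, div_eq_inv_mul]
  gcongr
  refine (norm_sub_le _ _).trans ?_
  linarith [norm_pow_apply_le hT (n + 1) x]

/-- Limit points of Cesàro averaged functionals are invariant. -/
theorem exists_invariant_functional {T : E →L[ℂ] E} (hT : ‖T‖ ≤ 1) (f : ℕ → E →L[ℂ] ℂ)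
    (hf : ∀ n, ‖f n‖ ≤ 1) :
    ∃ g : E →L[ℂ] ℂ, ‖g‖ ≤ 1 ∧ (∀ x, g (T x) = g x) ∧
      ∀ x, Tendsto (fun n => f n (cesaro T n x)) (hyperfilter ℕ : Filter ℕ) (𝓝 (g x)) := by
  obtain ⟨g, hg, hlim⟩ := exists_tendsto_hyperfilter (fun n => (f n).comp (cesaro T n)) fun n =>
    (ContinuousLinearMap.opNorm_comp_le _ _).trans
      (mul_le_one₀ (hf n) (norm_nonneg _) (norm_cesaro_le hT n))
  refine ⟨g, hg, fun x => ?_, hlim⟩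
  rw [← sub_eq_zero, ← map_sub]
  refine tendsto_nhds_unique (hlim (T x - x)) (Tendsto.mono_left ?_ (Nat.hyperfilter_le_atTop))
  refine squeeze_zero_norm (a := fun n : ℕ => 2 * ‖x‖ * (1 / ((n : ℝ) + 1))) (fun n => ?_) ?_
  · refine ((f n).le_of_opNorm_le (hf n) _).trans ?_
    rw [one_mul, mul_one_div]
    exact norm_cesaro_sub_le hT n x
  · simpa using tendsto_one_div_add_atTop_nhds_zero_nat.const_mul (2 * ‖x‖)

end Cesaro

/-! ### Contractive unital functionals and vector states -/

section States

variable {M : Type*} [CStarAlgebra M]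

/-- A contractive unital functional takes real values at self-adjoint elements: otherwise
`h + i t` with `t` large would violate contractivity. -/
theorem im_apply_eq_zero_of_isSelfAdjoint {φ : M →L[ℂ] ℂ} (hφ : ‖φ‖ ≤ 1) (h1 : φ 1 = 1) {h : M}
    (hh : IsSelfAdjoint h) : (φ h).im = 0 := by
  have h11 : ‖(1 : M)‖ ≤ 1 := by
    nontriviality M
    exact CStarRing.norm_one.le
  have key : ∀ t : ℝ, ((φ h).im + t) ^ 2 ≤ ‖h‖ ^ 2 + t ^ 2 := fun t => by
    set z : M := h + (Complex.I * t) • (1 : M) with hz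
    have hφz : φ z = φ h + Complex.I * t := by simp [hz, h1]
    have hzz : star z * z = h * h + ((t : ℂ) ^ 2) • (1 : M) := by
      rw [hz, star_add, star_smul, star_one, hh.star_eq]
      simp only [add_mul, mul_add, smul_mul_assoc, mul_smul_comm, one_mul, mul_one,
        star_mul', Complex.star_def, Complex.conj_I, Complex.conj_ofReal]
      have ht : -((Complex.I * t) * (Complex.I * t)) = (t : ℂ) ^ 2 := by
        linear_combination (-(t : ℂ) ^ 2) * Complex.I_sq
      rw [← ht]
      module
    have hn : ‖z‖ ^ 2 ≤ ‖h‖ ^ 2 + t ^ 2 := by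
      rw [sq, ← CStarRing.norm_star_mul_self, hzz]
      refine (norm_add_le _ _).trans (add_le_add ?_ ?_)
      · rw [sq]; exact norm_mul_le _ _
      · rw [norm_smul]
        simpa using mul_le_mul_of_nonneg_left h11 (sq_nonneg t)
    have him : |(φ h).im + t| ≤ ‖z‖ := by
      have := (Complex.abs_im_le_norm (φ z)).trans (φ.le_of_opNorm_le hφ z)
      simpa [hφz] using this
    calc ((φ h).im + t) ^ 2 = |(φ h).im + t| ^ 2 := (sq_abs _).symm
      _ ≤ ‖z‖ ^ 2 := by gcongr
      _ ≤ _ := hn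
  by_contra hne
  -- This `t` makes the cross term `2 t Im φ(h)` equal to `2 ‖h‖²`.
  have := key (‖h‖ ^ 2 / (φ h).im)
  have h2 : (φ h).im * (‖h‖ ^ 2 / (φ h).im) = ‖h‖ ^ 2 := mul_div_cancel₀ _ hne
  have h3 : 0 < (φ h).im ^ 2 := by positivity
  nlinarith [sq_nonneg ‖h‖]

/-- Contractive unital functionals are positive. -/
theorem apply_star_mul_self_nonneg {φ : M →L[ℂ] ℂ} (hφ : ‖φ‖ ≤ 1) (h1 : φ 1 = 1) (a : M) :
    0 ≤ φ (star a * a) := by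
  let _ : PartialOrder M := CStarAlgebra.spectralOrder M
  have _ : StarOrderedRing M := CStarAlgebra.spectralOrderedRing M
  set p := star a * a with hp
  have hsa : IsSelfAdjoint p := IsSelfAdjoint.star_mul_self a
  have him := im_apply_eq_zero_of_isSelfAdjoint hφ h1 hsa
  have hle : p ≤ algebraMap ℝ M ‖p‖ := hsa.le_algebraMap_norm_self
  have hp0 : 0 ≤ p := star_mul_self_nonneg a
  have hn : ‖algebraMap ℝ M ‖p‖ - p‖ ≤ ‖p‖ := by
    refine (CStarAlgebra.norm_le_norm_of_nonneg_of_le (sub_nonneg.2 hle)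
      (sub_le_self _ hp0)).trans ?_
    nontriviality M
    simp
  have hre : |‖p‖ - (φ p).re| ≤ ‖p‖ := by
    have h2 : φ (algebraMap ℝ M ‖p‖ - p) = ‖p‖ - φ p := by
      rw [map_sub, IsScalarTower.algebraMap_apply ℝ ℂ M, Algebra.algebraMap_eq_smul_one, map_smul,
        h1]
      simp
    have := (Complex.abs_re_le_norm _).trans ((φ.le_of_opNorm_le hφ _).trans
      ((one_mul _).trans_le hn))
    simpa [h2] using this
  rw [Complex.nonneg_iff]
  exact ⟨by linarith [(abs_le.1 hre).2], him.symm⟩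

variable {K : Type*} [NormedAddCommGroup K] [InnerProductSpace ℂ K]

/-- The norm of an operator is at most twice its numerical radius. -/
theorem norm_le_two_mul_of_numericalRadius_le (y : K →L[ℂ] K) {c : ℝ} (hc : 0 ≤ c)
    (h : ∀ ζ : K, ‖⟪y ζ, ζ⟫_ℂ‖ ≤ c * ‖ζ‖ ^ 2) : ‖y‖ ≤ 2 * c := by
  have key : ∀ ξ η : K, ‖⟪y η, ξ⟫_ℂ‖ ≤ c * (‖ξ‖ ^ 2 + ‖η‖ ^ 2) := fun ξ η => by
    have hpol := inner_map_polarization (y : K →ₗ[ℂ] K) ξ η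
    simp only [ContinuousLinearMap.coe_coe] at hpol
    rw [hpol, norm_div, div_le_iff₀ (by norm_num)]
    have p1 := parallelogram_law_with_norm ℂ ξ η
    have p2 := parallelogram_law_with_norm ℂ ξ (Complex.I • η)
    have hI : ‖Complex.I • η‖ = ‖η‖ := by rw [norm_smul, Complex.norm_I, one_mul]
    rw [hI] at p2
    have e1 := h (ξ + η)
    have e2 := h (ξ - η)
    have e3 := h (ξ + Complex.I • η)
    have e4 := h (ξ - Complex.I • η)
    refine ((norm_sub_le _ _).trans (add_le_add_left ((norm_add_le _ _).trans
      (add_le_add_left (norm_sub_le _ _) _)) _)).trans ?_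
    rw [norm_mul, norm_mul, Complex.norm_I, one_mul, one_mul, Complex.norm_ofNat]
    nlinarith
  refine y.opNorm_le_of_unit_norm (by positivity) fun η hη => ?_
  rcases eq_or_ne (y η) 0 with h0 | h0
  · rw [h0, norm_zero]; positivity
  · have hy : 0 < ‖y η‖ := norm_pos_iff.2 h0
    -- The unit vector in the direction of `y η` recovers `‖y η‖` from the sesquilinear bound.
    have := key (((‖y η‖⁻¹ : ℝ) : ℂ) • y η) η
    rw [inner_smul_right, inner_self_eq_norm_sq_to_K, norm_smul, hη] at this
    simp only [Complex.norm_real, norm_inv, norm_norm, norm_mul, Complex.coe_algebraMap,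
      inv_mul_cancel₀ hy.ne', sq] at this
    rw [inv_mul_cancel_left₀ hy.ne'] at this
    linarith

/-- The vector state `y ↦ ⟪ξ, y ξ⟫`. -/
def vectorState (ξ : K) : (K →L[ℂ] K) →L[ℂ] ℂ :=
  (innerSL ℂ ξ).comp (ContinuousLinearMap.apply ℂ K ξ)

theorem vectorState_apply (ξ : K) (y : K →L[ℂ] K) : vectorState ξ y = ⟪ξ, y ξ⟫_ℂ := rfl

theorem norm_vectorState_le {ξ : K} (hξ : ‖ξ‖ = 1) : ‖vectorState ξ‖ ≤ 1 :=
  ContinuousLinearMap.opNorm_le_bound _ zero_le_one fun y => by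
    rw [vectorState_apply, one_mul]
    refine (norm_inner_le_norm _ _).trans ?_
    rw [hξ, one_mul]
    simpa [hξ] using y.le_opNorm ξ

theorem exists_vectorState_norm_ge (y : K →L[ℂ] K) {ε : ℝ} (hε : 0 < ε) (h : ε ≤ ‖y‖) :
    ∃ ξ : K, ‖ξ‖ = 1 ∧ ε / 4 ≤ ‖vectorState ξ y‖ := by
  by_contra! hcon
  have := norm_le_two_mul_of_numericalRadius_le y (c := ε / 4) (by positivity) fun ζ => by
    rcases eq_or_ne ζ 0 with rfl | hζ
    · simp
    · have hz : 0 < ‖ζ‖ := norm_pos_iff.2 hζ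
      have hu := hcon (((‖ζ‖⁻¹ : ℝ) : ℂ) • ζ) (by
        rw [norm_smul, Complex.norm_real, norm_inv, norm_norm, inv_mul_cancel₀ hz.ne'])
      rw [vectorState_apply, map_smul, inner_smul_left, inner_smul_right, norm_mul, norm_mul,
        RCLike.norm_conj, Complex.norm_real, norm_inv, norm_norm, ← norm_inner_symm] at hu
      have : ‖⟪y ζ, ζ⟫_ℂ‖ = ‖ζ‖ ^ 2 * (‖ζ‖⁻¹ * (‖ζ‖⁻¹ * ‖⟪y ζ, ζ⟫_ℂ‖)) := by
        field_simp
      rw [this, mul_comm]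
      gcongr
  linarith

end States

/-! ### The Markov operator of a measure -/

section Markov

theorem hasSum_pmf_toReal {Γ : Type*} (μ : PMF Γ) : HasSum (fun s => (μ s).toReal) 1 := by
  have h := (ENNReal.hasSum_toReal (f := μ) (by rw [μ.tsum_coe]; exact ENNReal.one_ne_top))
  rwa [← ENNReal.tsum_toReal_eq fun s => μ.apply_ne_top s, μ.tsum_coe, ENNReal.toReal_one] at h

variable {Γ M : Type*} [Group Γ] [CStarAlgebra M]

theorem norm_innerAction (u : Γ →* unitary M) (s : Γ) (x : M) : ‖innerAction u s x‖ = ‖x‖ :=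
  NonUnitalStarAlgHom.norm_map (innerAction u s) (innerAction u s).injective x

theorem norm_markov_term (u : Γ →* unitary M) (μ : PMF Γ) (x : M) (s : Γ) :
    ‖((μ s).toReal : ℂ) • innerAction u s⁻¹ x‖ = (μ s).toReal * ‖x‖ := by
  rw [norm_smul, norm_innerAction, Complex.norm_real, Real.norm_of_nonneg ENNReal.toReal_nonneg]

theorem summable_markov (u : Γ →* unitary M) (μ : PMF Γ) (x : M) :
    Summable fun s : Γ => ((μ s).toReal : ℂ) • innerAction u s⁻¹ x :=
  Summable.of_norm <| by
    simp only [norm_markov_term]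
    exact (hasSum_pmf_toReal μ).summable.mul_right _

/-- The Markov operator `x ↦ ∑ₛ μ(s) s⁻¹x` of a measure `μ`, for the inner action attached to
a unitary representation. A continuous functional `φ` is `μ`-stationary if and only if
`φ (markov u μ x) = φ x` for all `x`. -/
def markov (u : Γ →* unitary M) (μ : PMF Γ) : M →L[ℂ] M :=
  LinearMap.mkContinuous
    { toFun := fun x => ∑' s : Γ, ((μ s).toReal : ℂ) • innerAction u s⁻¹ x
      map_add' := fun x y => by
        rw [← (summable_markov u μ x).tsum_add (summable_markov u μ y)]
        simp only [map_add, smul_add]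
      map_smul' := fun c x => by
        rw [RingHom.id_apply, ← (summable_markov u μ x).tsum_const_smul c]
        simp only [map_smul, smul_comm c] }
    1 fun x => by
      rw [one_mul]
      refine tsum_of_norm_bounded (g := fun s : Γ => (μ s).toReal * ‖x‖) ?_
        fun s => (norm_markov_term u μ x s).le
      simpa using (hasSum_pmf_toReal μ).mul_right ‖x‖

theorem hasSum_markov (u : Γ →* unitary M) (μ : PMF Γ) (x : M) :
    HasSum (fun s : Γ => ((μ s).toReal : ℂ) • innerAction u s⁻¹ x) (markov u μ x) :=
  (summable_markov u μ x).hasSum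

theorem norm_markov_le (u : Γ →* unitary M) (μ : PMF Γ) : ‖markov u μ‖ ≤ 1 :=
  LinearMap.mkContinuous_norm_le _ zero_le_one _

theorem markov_one (u : Γ →* unitary M) (μ : PMF Γ) : markov u μ 1 = 1 := by
  have h : HasSum (fun s : Γ => ((μ s).toReal : ℂ) • innerAction u s⁻¹ (1 : M))
      ((1 : ℂ) • (1 : M)) := by
    simp only [map_one]
    exact (Complex.hasSum_ofReal.2 (by simpa using hasSum_pmf_toReal μ)).smul_const (1 : M)
  rw [one_smul] at h
  exact (hasSum_markov u μ 1).unique h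

theorem markov_mem {u : Γ →* unitary M} (μ : PMF Γ) {J : Submodule ℂ M}
    (hJc : IsClosed (J : Set M)) (hJ : ∀ s, ∀ x ∈ J, innerAction u s x ∈ J) {x : M}
    (hx : x ∈ J) : markov u μ x ∈ J :=
  hJc.mem_of_tendsto (hasSum_markov u μ x) <| Filter.Eventually.of_forall fun _ =>
    J.sum_mem fun s _ => J.smul_mem _ (hJ s⁻¹ x hx)

theorem hasSum_apply_of_markov_invariant {u : Γ →* unitary M} {μ : PMF Γ} {φ : M →L[ℂ] ℂ}
    (hφ : ∀ x, φ (markov u μ x) = φ x) (x : M) :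
    HasSum (fun s : Γ => ((μ s).toReal : ℂ) * φ (innerAction u s⁻¹ x)) (φ x) := by
  have := φ.hasSum (hasSum_markov u μ x)
  simpa [hφ] using! this

/-- A closed invariant subspace at distance at least `1` from the unit is annihilated by a
contractive unital functional that is invariant under the Markov operator: averaging a
Hahn–Banach functional keeps it zero on the subspace. -/
theorem exists_invariant_functional_vanishing (u : Γ →* unitary M) (μ : PMF Γ)
    {J : Submodule ℂ M} (hJc : IsClosed (J : Set M))
    (hJ : ∀ s, ∀ x ∈ J, innerAction u s x ∈ J) (hdist : ∀ x ∈ J, 1 ≤ ‖1 - x‖) :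
    ∃ φ : M →L[ℂ] ℂ, ‖φ‖ ≤ 1 ∧ φ 1 = 1 ∧ (∀ x, φ (markov u μ x) = φ x) ∧ ∀ x ∈ J, φ x = 0 := by
  have h1M : ‖(1 : M)‖ ≤ 1 := by
    nontriviality M
    exact CStarRing.norm_one.le
  have hq : ‖(Submodule.Quotient.mk (1 : M) : M ⧸ J)‖ = 1 := by
    refine le_antisymm ((Submodule.Quotient.norm_mk_le J 1).trans h1M) (le_of_forall_pos_le_add ?_)
    intro ε hε
    obtain ⟨m, hm, hlt⟩ := Submodule.Quotient.norm_mk_lt (Submodule.Quotient.mk (1 : M) : M ⧸ J) hε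
    have := hdist (1 - m) ((Submodule.Quotient.eq J).1 hm.symm)
    rw [sub_sub_cancel] at this
    linarith
  obtain ⟨g, hg, hg1⟩ := exists_dual_vector ℂ (Submodule.Quotient.mk (1 : M) : M ⧸ J) (by simp [hq])
  let f : M →L[ℂ] ℂ := LinearMap.mkContinuous (g.toLinearMap.comp J.mkQ) 1 fun x => by
    refine (g.le_of_opNorm_le hg.le _).trans ?_
    gcongr
    exact Submodule.Quotient.norm_mk_le J x
  have hf : ∀ x, f x = g (Submodule.Quotient.mk x) := fun _ => rfl
  obtain ⟨φ, hφ, hinv, hlim⟩ := exists_invariant_functional (norm_markov_le u μ) (fun _ => f)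
    fun _ => LinearMap.mkContinuous_norm_le _ zero_le_one _
  refine ⟨φ, hφ, ?_, hinv, fun x hx => ?_⟩
  · refine tendsto_nhds_unique (hlim 1) ?_
    simp only [cesaro_apply_of_fixed (markov_one u μ)]
    rw [hf, hg1, hq]
    exact tendsto_const_nhds
  · refine tendsto_nhds_unique (hlim x) ?_
    have hz : ∀ n, f (cesaro (markov u μ) n x) = 0 := fun n => by
      rw [hf, (Submodule.Quotient.mk_eq_zero J).2
        (cesaro_mem (fun y hy => markov_mem μ hJc hJ hy) n hx), map_zero]
    simp only [hz]
    exact tendsto_const_nhds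

end Markov

/-! ### Averaging in the reduced group C⋆-algebra -/

section Averaging

variable {Γ : Type*} [Group Γ]

theorem apply_leftTranslation_eq_zero {μ : PMF Γ} (hμ : IsCStarSimpleMeasure μ)
    {φ : (L2 Γ ℂ →L[ℂ] L2 Γ ℂ) →L[ℂ] ℂ} (hφ : ‖φ‖ ≤ 1) (h1 : φ 1 = 1)
    (hinv : ∀ x, φ (markov (leftTranslation Γ ℂ) μ x) = φ x) {t : Γ} (ht : t ≠ 1) :
    φ (leftTranslation Γ ℂ t) = 0 := by
  classical
  have key : φ.toLinearMap ∘ₗ (reducedGroupCStar Γ).subtype.toAlgHom.toLinearMap =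
      canonicalTrace Γ := by
    refine (hμ _).1 ⟨⟨fun a => ?_, h1⟩, fun a => ?_⟩
    · exact apply_star_mul_self_nonneg hφ h1 (a : L2 Γ ℂ →L[ℂ] L2 Γ ℂ)
    · exact hasSum_apply_of_markov_invariant hinv (a : L2 Γ ℂ →L[ℂ] L2 Γ ℂ)
  have hmem : (leftTranslation Γ ℂ t : L2 Γ ℂ →L[ℂ] L2 Γ ℂ) ∈ reducedGroupCStar Γ :=
    subset_generatedCStar (M := L2 Γ ℂ →L[ℂ] L2 Γ ℂ) _ ⟨t, rfl⟩
  have h := LinearMap.congr_fun key ⟨_, hmem⟩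
  refine Eq.trans h ?_
  change ⟪_, (leftTranslation Γ ℂ t : L2 Γ ℂ →L[ℂ] L2 Γ ℂ) _⟫_ℂ = 0
  rw [lp.inner_single_left, leftTranslation_apply, lp.single_apply_ne, inner_zero_right]
  simpa using ht

/-- For a C⋆-simple measure the Cesàro means of the conjugates of `λₜ`, `t ≠ 1`, come arbitrarily
close to `0` in norm. Otherwise vector states of the means stay away from `0`, and averaging them
yields a stationary state that differs from the canonical trace. -/
theorem exists_norm_cesaro_lt {μ : PMF Γ} (hμ : IsCStarSimpleMeasure μ) {t : Γ} (ht : t ≠ 1)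
    {ε : ℝ} (hε : 0 < ε) :
    ∃ n, ‖cesaro (markov (leftTranslation Γ ℂ) μ) n
      (leftTranslation Γ ℂ t : L2 Γ ℂ →L[ℂ] L2 Γ ℂ)‖ < ε := by
  by_contra! hcon
  choose ξ hξ hge using fun n => exists_vectorState_norm_ge _ hε (hcon n)
  obtain ⟨φ, hφ, hinv, hlim⟩ := exists_invariant_functional
    (norm_markov_le (leftTranslation Γ ℂ) μ) (fun n => vectorState (ξ n))
    fun n => norm_vectorState_le (hξ n)
  have h1 : φ 1 = 1 := by
    refine tendsto_nhds_unique (hlim 1) ?_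
    simp only [cesaro_apply_of_fixed (markov_one (leftTranslation Γ ℂ) μ), vectorState_apply,
      one_apply_eq_self, inner_self_eq_norm_sq_to_K, hξ]
    simp
  have h0 := apply_leftTranslation_eq_zero hμ hφ h1 hinv ht
  have := ge_of_tendsto (hlim _).norm (Filter.Eventually.of_forall hge)
  rw [h0, norm_zero] at this
  linarith

end Averaging

/-! ### Domination of operators on `ℓ²(Γ, H)` by operators on `ℓ²(Γ)` -/

section PointwiseNorm

variable {Γ H : Type*} [NormedAddCommGroup H]

theorem memlp_norm (ξ : L2 Γ H) : Memℓp (fun t => ((‖ξ t‖ : ℝ) : ℂ)) 2 :=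
  memlp_two_iff.2 (by simpa using ξ.summable)

/-- The pointwise norm of an element of `ℓ²(Γ, H)`, as an element of `ℓ²(Γ)`. -/
def pointwiseNorm (ξ : L2 Γ H) : L2 Γ ℂ :=
  ⟨fun t => ((‖ξ t‖ : ℝ) : ℂ), memlp_norm ξ⟩

theorem norm_pointwiseNorm (ξ : L2 Γ H) : ‖pointwiseNorm ξ‖ = ‖ξ‖ := by
  refine (sq_eq_sq₀ (norm_nonneg _) (norm_nonneg _)).1 ?_
  rw [L2.norm_sq, L2.norm_sq]
  simp [pointwiseNorm]

end PointwiseNorm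

section Domination

variable {Γ H : Type*} [NormedAddCommGroup H] [InnerProductSpace ℂ H]

/-- The operator `y` on `ℓ²(Γ, H)` is dominated by the operator `z` on `ℓ²(Γ)` if
`‖(y ξ)(t)‖ ≤ (z ‖ξ‖)(t)` for all `ξ` and `t`. The right-hand side is meant to be real and
nonnegative; taking its real part is enough for the norm estimate. -/
def IsDominated (y : L2 Γ H →L[ℂ] L2 Γ H) (z : L2 Γ ℂ →L[ℂ] L2 Γ ℂ) : Prop :=
  ∀ ξ t, ‖y ξ t‖ ≤ (z (pointwiseNorm ξ) t).re

namespace IsDominated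

variable {y y' : L2 Γ H →L[ℂ] L2 Γ H} {z z' : L2 Γ ℂ →L[ℂ] L2 Γ ℂ}

theorem norm_le (h : IsDominated y z) : ‖y‖ ≤ ‖z‖ := by
  refine y.opNorm_le_bound (norm_nonneg z) fun ξ => ?_
  rw [← norm_pointwiseNorm ξ]
  refine le_trans ?_ (z.le_opNorm _)
  refine (sq_le_sq₀ (norm_nonneg _) (norm_nonneg _)).1 ?_
  rw [L2.norm_sq, L2.norm_sq]
  refine Summable.tsum_le_tsum (fun t => ?_) (L2.summable _) (L2.summable _)
  gcongr
  exact (h ξ t).trans (Complex.re_le_norm _)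

protected theorem zero : IsDominated (0 : L2 Γ H →L[ℂ] L2 Γ H) 0 := fun ξ t => by simp

theorem add (h : IsDominated y z) (h' : IsDominated y' z') : IsDominated (y + y') (z + z') :=
  fun ξ t => (norm_add_le _ _).trans (add_le_add (h ξ t) (h' ξ t))

theorem smul (h : IsDominated y z) {r : ℝ} (hr : 0 ≤ r) :
    IsDominated ((r : ℂ) • y) ((r : ℂ) • z) := fun ξ t => by
  have h1 : ((r : ℂ) • y) ξ t = (r : ℂ) • y ξ t := rfl
  have h2 : ((r : ℂ) • z) (pointwiseNorm ξ) t = (r : ℂ) * z (pointwiseNorm ξ) t := rfl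
  rw [h1, h2, norm_smul, Complex.norm_real, Real.norm_of_nonneg hr, Complex.re_ofReal_mul]
  gcongr
  exact h ξ t

theorem sum {ι : Type*} (F : Finset ι) {y : ι → L2 Γ H →L[ℂ] L2 Γ H}
    {z : ι → L2 Γ ℂ →L[ℂ] L2 Γ ℂ} (h : ∀ i ∈ F, IsDominated (y i) (z i)) :
    IsDominated (∑ i ∈ F, y i) (∑ i ∈ F, z i) := by
  classical
  induction F using Finset.induction_on with
  | empty => simpa using IsDominated.zero
  | insert i F hi ih =>
    rw [Finset.sum_insert hi, Finset.sum_insert hi]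
    exact (h i (Finset.mem_insert_self i F)).add
      (ih fun j hj => h j (Finset.mem_insert_of_mem hj))

theorem of_tendsto {ι : Type*} {l : Filter ι} [l.NeBot] {f : ι → L2 Γ H →L[ℂ] L2 Γ H}
    {g : ι → L2 Γ ℂ →L[ℂ] L2 Γ ℂ} (hf : Filter.Tendsto f l (nhds y))
    (hg : Filter.Tendsto g l (nhds z)) (h : ∀ i, IsDominated (f i) (g i)) :
    IsDominated y z := fun ξ t => by
  have c1 : Continuous fun w : L2 Γ H →L[ℂ] L2 Γ H => ‖w ξ t‖ :=
    ((lp.evalCLM ℂ (fun _ : Γ => H) 2 t).comp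
      (ContinuousLinearMap.apply ℂ (L2 Γ H) ξ)).continuous.norm
  have c2 : Continuous fun w : L2 Γ ℂ →L[ℂ] L2 Γ ℂ => (w (pointwiseNorm ξ) t).re :=
    Complex.continuous_re.comp ((lp.evalCLM ℂ (fun _ : Γ => ℂ) 2 t).comp
      (ContinuousLinearMap.apply ℂ (L2 Γ ℂ) (pointwiseNorm ξ))).continuous
  exact le_of_tendsto_of_tendsto' ((c1.tendsto y).comp hf) ((c2.tendsto z).comp hg)
    fun i => h i ξ t

end IsDominated

end Domination

/-! ### Diagonal matrix entries of operators on `ℓ²(Γ, H)` -/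

section Compression

variable {Γ H : Type*} [NormedAddCommGroup H] [InnerProductSpace ℂ H]

open Classical in
/-- The diagonal matrix entry at `t` of an operator on `ℓ²(Γ, H)`. -/
def compression (t : Γ) : (L2 Γ H →L[ℂ] L2 Γ H) →L[ℂ] (H →L[ℂ] H) :=
  ((lp.evalCLM ℂ (fun _ : Γ => H) 2 t).postcomp H).comp
    ((lp.singleContinuousLinearMap ℂ (fun _ : Γ => H) 2 t).precomp (L2 Γ H))

open Classical in
theorem compression_apply (t : Γ) (x : L2 Γ H →L[ℂ] L2 Γ H) (v : H) :
    compression t x v = x (lp.single 2 t v) t := rfl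

theorem norm_compression_le (t : Γ) (x : L2 Γ H →L[ℂ] L2 Γ H) : ‖compression t x‖ ≤ ‖x‖ := by
  classical
  refine ContinuousLinearMap.opNorm_le_bound _ (norm_nonneg x) fun v => ?_
  rw [compression_apply]
  refine (lp.norm_apply_le_norm two_ne_zero _ t).trans ((x.le_opNorm _).trans_eq ?_)
  rw [lp.norm_single (by norm_num)]

variable [CompleteSpace H]

open Classical in
theorem inner_compression_star_mul_self (t : Γ) (x : L2 Γ H →L[ℂ] L2 Γ H) (v : H) :
    ⟪compression t (star x * x) v, v⟫_ℂ = ((‖x (lp.single 2 t v)‖ ^ 2 : ℝ) : ℂ) := by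
  rw [compression_apply, ← lp.inner_single_right, mul_apply_eq_comp,
    ContinuousLinearMap.star_eq_adjoint, ContinuousLinearMap.adjoint_inner_left,
    inner_self_eq_norm_sq_to_K]
  simp

theorem compression_star_mul_self_nonneg (t : Γ) (x : L2 Γ H →L[ℂ] L2 Γ H) :
    0 ≤ compression t (star x * x) := by
  classical
  rw [ContinuousLinearMap.nonneg_iff_isPositive, ContinuousLinearMap.isPositive_iff_complex]
  intro v
  rw [inner_compression_star_mul_self]
  exact ⟨by rw [RCLike.re_to_complex, Complex.ofReal_re],
    by rw [RCLike.re_to_complex, Complex.ofReal_re]; positivity⟩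

/-- Faithfulness of the expectation onto the diagonal: the diagonal entries of `x⋆ x` are the
squared norms of the columns of `x`. -/
theorem eq_zero_of_compression_eq_zero {x : L2 Γ H →L[ℂ] L2 Γ H}
    (h : ∀ t, compression t (star x * x) = 0) : x = 0 := by
  classical
  refine lp.ext_continuousLinearMap (by norm_num) fun t => ?_
  ext1 v
  have := inner_compression_star_mul_self t x v
  rw [h t, zero_apply, inner_zero_left] at this
  simpa using this.symm

end Compression

/-! ### Stationary functionals vanish off the diagonal -/

section CrossedProduct

variable {Γ A H : Type*} [Group Γ] [CStarAlgebra A]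
  [NormedAddCommGroup H] [InnerProductSpace ℂ H] [CompleteSpace H]

theorem star_leftTranslation (s : Γ) :
    star (leftTranslation Γ H s : L2 Γ H →L[ℂ] L2 Γ H) = leftTranslation Γ H s⁻¹ := by
  rw [map_inv]
  rfl

theorem innerAction_leftTranslation_apply (s : Γ) (y : L2 Γ H →L[ℂ] L2 Γ H) (ξ : L2 Γ H) (t : Γ) :
    innerAction (leftTranslation Γ H) s y ξ t =
      y ((leftTranslation Γ H s⁻¹ : L2 Γ H →L[ℂ] L2 Γ H) ξ) (s⁻¹ * t) := by
  rw [innerAction_apply, star_leftTranslation]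
  rfl

namespace IsDominated

variable {y : L2 Γ H →L[ℂ] L2 Γ H} {z : L2 Γ ℂ →L[ℂ] L2 Γ ℂ}

theorem innerAction (h : IsDominated y z) (s : Γ) :
    IsDominated (innerAction (leftTranslation Γ H) s y)
      (GammaCStar.innerAction (leftTranslation Γ ℂ) s z) := fun ξ t => by
  rw [innerAction_leftTranslation_apply, innerAction_leftTranslation_apply]
  exact h _ _

theorem markov (h : IsDominated y z) (μ : PMF Γ) :
    IsDominated (markov (leftTranslation Γ H) μ y)
      (GammaCStar.markov (leftTranslation Γ ℂ) μ z) :=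
  of_tendsto (hasSum_markov _ μ y) (hasSum_markov _ μ z) fun F =>
    IsDominated.sum F fun s _ => (h.innerAction s⁻¹).smul ENNReal.toReal_nonneg

theorem cesaro (h : IsDominated y z) (μ : PMF Γ) (n : ℕ) :
    IsDominated (cesaro (GammaCStar.markov (leftTranslation Γ H) μ) n y)
      (GammaCStar.cesaro (GammaCStar.markov (leftTranslation Γ ℂ) μ) n z) := by
  have hk : ∀ k, IsDominated ((GammaCStar.markov (leftTranslation Γ H) μ ^ k) y)
      ((GammaCStar.markov (leftTranslation Γ ℂ) μ ^ k) z) := fun k => by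
    induction k with
    | zero => exact h
    | succ k ih =>
      rw [pow_succ', pow_succ']
      exact ih.markov μ
  rw [cesaro_apply, cesaro_apply]
  have := (IsDominated.sum (Finset.range (n + 1)) fun k _ => hk k).smul
    (r := ((n : ℝ) + 1)⁻¹) (by positivity)
  simpa using this

end IsDominated

theorem isDominated_diagonal_mul_leftTranslation (α : Γ →* (A ≃⋆ₐ[ℂ] A))
    (π : A →⋆ₐ[ℂ] (H →L[ℂ] H)) (a : A) (s : Γ) :
    IsDominated (diagonal α π a * (leftTranslation Γ H s : L2 Γ H →L[ℂ] L2 Γ H))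
      ((‖a‖ : ℂ) • (leftTranslation Γ ℂ s : L2 Γ ℂ →L[ℂ] L2 Γ ℂ)) := fun ξ t => by
  have h1 : (diagonal α π a * (leftTranslation Γ H s : L2 Γ H →L[ℂ] L2 Γ H)) ξ t =
    π (α t⁻¹ a) (ξ (s⁻¹ * t)) := rfl
  have h2 : ((‖a‖ : ℂ) • (leftTranslation Γ ℂ s : L2 Γ ℂ →L[ℂ] L2 Γ ℂ)) (pointwiseNorm ξ) t =
    (‖a‖ : ℂ) * ((‖ξ (s⁻¹ * t)‖ : ℝ) : ℂ) := rfl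
  rw [h1, h2, Complex.re_ofReal_mul, Complex.ofReal_re]
  refine (sq_le_sq₀ (norm_nonneg _) (by positivity)).1 ?_
  rw [mul_pow]
  exact norm_diagonal_le α π a t _

/-- A functional on `B(ℓ²(Γ, H))` that is stationary for a C⋆-simple measure vanishes at
`σ(a) λₛ`, `s ≠ 1`: the Cesàro means of this operator are dominated by `‖a‖` times those
of `λₛ` in the reduced group C⋆-algebra. -/
theorem apply_diagonal_mul_leftTranslation_eq_zero {μ : PMF Γ} (hμ : IsCStarSimpleMeasure μ)
    (α : Γ →* (A ≃⋆ₐ[ℂ] A)) (π : A →⋆ₐ[ℂ] (H →L[ℂ] H))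
    {φ : (L2 Γ H →L[ℂ] L2 Γ H) →L[ℂ] ℂ} (hφ : ‖φ‖ ≤ 1)
    (hinv : ∀ x, φ (markov (leftTranslation Γ H) μ x) = φ x) (a : A) {s : Γ} (hs : s ≠ 1) :
    φ (diagonal α π a * (leftTranslation Γ H s : L2 Γ H →L[ℂ] L2 Γ H)) = 0 := by
  set x := diagonal α π a * (leftTranslation Γ H s : L2 Γ H →L[ℂ] L2 Γ H) with hx
  have hpow : ∀ k, φ ((markov (leftTranslation Γ H) μ ^ k) x) = φ x := fun k => by
    induction k with
    | zero => rfl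
    | succ k ih => rw [pow_succ', mul_apply_eq_comp, hinv, ih]
  have hces : ∀ n, φ (cesaro (markov (leftTranslation Γ H) μ) n x) = φ x := fun n => by
    have : (n : ℂ) + 1 ≠ 0 := by exact_mod_cast n.succ_ne_zero
    rw [cesaro_apply, map_smul, map_sum, Finset.sum_congr rfl fun k _ => hpow k, Finset.sum_const,
      Finset.card_range, nsmul_eq_mul, smul_eq_mul]
    push_cast
    rw [inv_mul_cancel_left₀ this]
  by_contra hne
  have hpos : 0 < ‖φ x‖ := norm_pos_iff.2 hne
  obtain ⟨n, hn⟩ := exists_norm_cesaro_lt hμ hs (ε := ‖φ x‖ / (‖a‖ + 1)) (by positivity)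
  have h1 : ‖φ x‖ ≤ ‖cesaro (markov (leftTranslation Γ H) μ) n x‖ := by
    rw [← hces n, ← one_mul ‖cesaro _ n x‖]
    exact φ.le_of_opNorm_le hφ _
  have h2 := ((isDominated_diagonal_mul_leftTranslation α π a s).cesaro μ n).norm_le
  rw [map_smul, norm_smul, Complex.norm_real, norm_norm] at h2
  rw [lt_div_iff₀ (by positivity)] at hn
  have := h1.trans h2
  nlinarith [norm_nonneg (cesaro (markov (leftTranslation Γ ℂ) μ) n
    (leftTranslation Γ ℂ s : L2 Γ ℂ →L[ℂ] L2 Γ ℂ))]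

/-! ### The canonical expectation of the reduced crossed product -/

variable (α : Γ →* (A ≃⋆ₐ[ℂ] A)) (π : A →⋆ₐ[ℂ] (H →L[ℂ] H))

theorem diagonal_one : diagonal α π 1 = 1 := by
  ext ξ t
  simp

theorem diagonal_add (a b : A) : diagonal α π (a + b) = diagonal α π a + diagonal α π b := by
  ext ξ t
  change π (α t⁻¹ (a + b)) (ξ t) = π (α t⁻¹ a) (ξ t) + π (α t⁻¹ b) (ξ t)
  simp

theorem diagonal_smul (c : ℂ) (a : A) : diagonal α π (c • a) = c • diagonal α π a := by
  ext ξ t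
  change π (α t⁻¹ (c • a)) (ξ t) = c • π (α t⁻¹ a) (ξ t)
  simp

theorem diagonal_mul (a b : A) : diagonal α π (a * b) = diagonal α π a * diagonal α π b := by
  ext ξ t
  change π (α t⁻¹ (a * b)) (ξ t) = π (α t⁻¹ a) (π (α t⁻¹ b) (ξ t))
  simp

theorem diagonal_star (a : A) : diagonal α π (star a) = star (diagonal α π a) := by
  rw [ContinuousLinearMap.star_eq_adjoint, ContinuousLinearMap.eq_adjoint_iff]
  intro ξ η
  rw [lp.inner_eq_tsum, lp.inner_eq_tsum]
  refine tsum_congr fun t => ?_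
  rw [diagonal_apply, diagonal_apply, map_star, map_star, ContinuousLinearMap.star_eq_adjoint,
    ContinuousLinearMap.adjoint_inner_left]

/-- The representation `a ↦ σ(a)` of `A` on `ℓ²(Γ, H)` as a continuous linear map. -/
def diagonalCLM : A →L[ℂ] (L2 Γ H →L[ℂ] L2 Γ H) :=
  LinearMap.mkContinuous
    { toFun := diagonal α π
      map_add' := diagonal_add α π
      map_smul' := diagonal_smul α π } 1 fun a => by
    rw [one_mul]
    change ‖diagonal α π a‖ ≤ ‖a‖
    unfold diagonal
    apply LinearMap.mkContinuous_norm_le _ (norm_nonneg a)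

theorem innerAction_diagonal (s : Γ) (a : A) :
    innerAction (leftTranslation Γ H) s (diagonal α π a) = diagonal α π (α s a) := by
  ext ξ t
  rw [innerAction_leftTranslation_apply, diagonal_apply, diagonal_apply, leftTranslation_apply,
    inv_inv, mul_inv_cancel_left, mul_inv_rev, inv_inv, map_mul, StarAlgEquiv.mul_apply]

theorem leftTranslation_mul_diagonal (s : Γ) (a : A) :
    (leftTranslation Γ H s : L2 Γ H →L[ℂ] L2 Γ H) * diagonal α π a =
      diagonal α π (α s a) * leftTranslation Γ H s := by
  rw [← innerAction_diagonal, innerAction_apply, mul_assoc, Unitary.coe_star_mul_self, mul_one]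

theorem leftTranslation_mul (s t : Γ) :
    (leftTranslation Γ H s : L2 Γ H →L[ℂ] L2 Γ H) * leftTranslation Γ H t =
      leftTranslation Γ H (s * t) := by
  rw [map_mul]
  rfl

/-- The linear span of the operators `σ(a) λₛ`, a dense subspace of the reduced crossed product. -/
def monomialSpan : Submodule ℂ (L2 Γ H →L[ℂ] L2 Γ H) :=
  Submodule.span ℂ (Set.range fun p : A × Γ =>
    diagonal α π p.1 * (leftTranslation Γ H p.2 : L2 Γ H →L[ℂ] L2 Γ H))

theorem monomial_mem (a : A) (s : Γ) :
    diagonal α π a * (leftTranslation Γ H s : L2 Γ H →L[ℂ] L2 Γ H) ∈ monomialSpan α π :=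
  Submodule.subset_span ⟨(a, s), rfl⟩

theorem diagonal_mem_monomialSpan (a : A) : diagonal α π a ∈ monomialSpan α π := by
  have := monomial_mem α π a 1
  rwa [map_one, OneMemClass.coe_one, mul_one] at this

theorem leftTranslation_mem_monomialSpan (s : Γ) :
    (leftTranslation Γ H s : L2 Γ H →L[ℂ] L2 Γ H) ∈ monomialSpan α π := by
  have := monomial_mem α π 1 s
  rwa [diagonal_one, one_mul] at this

theorem mul_mem_monomialSpan {x y : L2 Γ H →L[ℂ] L2 Γ H} (hx : x ∈ monomialSpan α π)
    (hy : y ∈ monomialSpan α π) : x * y ∈ monomialSpan α π := by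
  have h := Submodule.mul_mem_mul hx hy
  rw [monomialSpan, Submodule.span_mul_span] at h
  refine (Submodule.span_le.2 ?_) h
  rintro _ ⟨_, ⟨⟨a, s⟩, rfl⟩, _, ⟨⟨b, t⟩, rfl⟩, rfl⟩
  change diagonal α π a * (leftTranslation Γ H s : L2 Γ H →L[ℂ] L2 Γ H) *
    (diagonal α π b * (leftTranslation Γ H t : L2 Γ H →L[ℂ] L2 Γ H)) ∈ monomialSpan α π
  rw [mul_assoc, ← mul_assoc _ (diagonal α π b), leftTranslation_mul_diagonal, mul_assoc,
    leftTranslation_mul, ← mul_assoc, ← diagonal_mul]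
  exact monomial_mem α π _ _

theorem star_mem_monomialSpan {x : L2 Γ H →L[ℂ] L2 Γ H} (hx : x ∈ monomialSpan α π) :
    star x ∈ monomialSpan α π := by
  refine Submodule.span_induction (p := fun x _ => star x ∈ monomialSpan α π) ?_ ?_ ?_ ?_ hx
  · rintro _ ⟨⟨a, s⟩, rfl⟩
    change star (diagonal α π a * (leftTranslation Γ H s : L2 Γ H →L[ℂ] L2 Γ H)) ∈ _
    rw [star_mul, star_leftTranslation, ← diagonal_star, leftTranslation_mul_diagonal]
    exact monomial_mem α π _ _
  · rw [star_zero]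
    exact zero_mem _
  · intro x y _ _ hx hy
    rw [star_add]
    exact add_mem hx hy
  · intro c x _ hx
    rw [star_smul]
    exact Submodule.smul_mem _ _ hx

theorem mem_closure_monomialSpan {x : L2 Γ H →L[ℂ] L2 Γ H} (hx : x ∈ reducedCrossedProduct α π) :
    x ∈ closure (monomialSpan α π : Set (L2 Γ H →L[ℂ] L2 Γ H)) := by
  refine closure_mono (fun y hy => ?_) hx
  refine StarAlgebra.adjoin_induction (p := fun y _ => y ∈ monomialSpan α π) ?_ ?_ ?_ ?_ ?_ hy
  · rintro _ (⟨s, rfl⟩ | ⟨a, rfl⟩)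
    · exact leftTranslation_mem_monomialSpan α π s
    · exact diagonal_mem_monomialSpan α π a
  · intro c
    rw [Algebra.algebraMap_eq_smul_one, ← diagonal_one α π]
    exact Submodule.smul_mem _ _ (diagonal_mem_monomialSpan α π 1)
  · exact fun x y _ _ hx hy => add_mem hx hy
  · exact fun x y _ _ hx hy => mul_mem_monomialSpan α π hx hy
  · exact fun x _ hx => star_mem_monomialSpan α π hx

theorem compression_diagonal (t : Γ) (a : A) :
    compression t (diagonal α π a) = π (α t⁻¹ a) := by
  classical
  ext v
  rw [compression_apply, diagonal_apply, lp.single_apply_self]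

theorem compression_monomial (t : Γ) (a : A) {s : Γ} (hs : s ≠ 1) :
    compression t (diagonal α π a * (leftTranslation Γ H s : L2 Γ H →L[ℂ] L2 Γ H)) = 0 := by
  classical
  ext v
  rw [compression_apply, mul_apply_eq_comp, diagonal_apply, leftTranslation_apply,
    lp.single_apply_ne, map_zero, zero_apply]
  simpa using hs

/-- The canonical expectation: every `x` in the reduced crossed product has a coefficient `a` in
`A` such that the diagonal of the operator matrix of `x` is that of `σ(a)`. A continuous
functional that vanishes at `σ(b) λₛ` for `s ≠ 1` takes the same value at `x` and at `σ(a)`. -/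
theorem exists_coefficient (hπ : Function.Injective π) {φ : (L2 Γ H →L[ℂ] L2 Γ H) →L[ℂ] ℂ}
    (hφ : ∀ (a : A) (s : Γ), s ≠ 1 →
      φ (diagonal α π a * (leftTranslation Γ H s : L2 Γ H →L[ℂ] L2 Γ H)) = 0)
    {x : L2 Γ H →L[ℂ] L2 Γ H} (hx : x ∈ reducedCrossedProduct α π) :
    ∃ a : A, (∀ t, compression t x = π (α t⁻¹ a)) ∧ φ x = φ (diagonal α π a) := by
  let P : (L2 Γ H →L[ℂ] L2 Γ H) → A → Prop := fun x a =>
    (∀ t, compression t x = compression t (diagonal α π a)) ∧ φ x = φ (diagonal α π a)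
  have hnorm : ∀ {x a}, P x a → ‖a‖ ≤ ‖x‖ := fun {x a} h => by
    have h1 := h.1 1
    rw [compression_diagonal, inv_one, map_one, StarAlgEquiv.one_apply] at h1
    rw [← NonUnitalStarAlgHom.norm_map π hπ a, ← h1]
    exact norm_compression_le 1 x
  have hsub : ∀ {x a y b}, P x a → P y b → P (x - y) (a - b) := fun {x a y b} h h' => by
    have hd : diagonal α π (a - b) = diagonal α π a - diagonal α π b :=
      map_sub (diagonalCLM α π) a b
    refine ⟨fun t => ?_, ?_⟩
    · rw [hd, map_sub, map_sub, h.1, h'.1]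
    · rw [hd, map_sub, map_sub, h.2, h'.2]
  have hspan : ∀ y ∈ monomialSpan α π, ∃ a, P y a := fun y hy => by
    refine Submodule.span_induction (p := fun y _ => ∃ a, P y a) ?_ ?_ ?_ ?_ hy
    · rintro _ ⟨⟨a, s⟩, rfl⟩
      by_cases hs : s = 1
      · refine ⟨a, ?_⟩
        simp only [hs, map_one, OneMemClass.coe_one, mul_one]
        exact ⟨fun _ => rfl, rfl⟩
      · have hd : diagonal α π 0 = 0 := map_zero (diagonalCLM α π)
        refine ⟨0, fun t => ?_, ?_⟩
        · rw [hd, map_zero]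
          exact compression_monomial α π t a hs
        · rw [hd, map_zero]
          exact hφ a s hs
    · have hd : diagonal α π 0 = 0 := map_zero (diagonalCLM α π)
      exact ⟨0, fun t => by rw [hd], by rw [hd]⟩
    · rintro x y _ _ ⟨a, ha⟩ ⟨b, hb⟩
      refine ⟨a + b, fun t => ?_, ?_⟩
      · rw [diagonal_add, map_add, map_add, ha.1, hb.1]
      · rw [diagonal_add, map_add, map_add, ha.2, hb.2]
    · rintro c x _ ⟨a, ha⟩
      refine ⟨c • a, fun t => ?_, ?_⟩
      · rw [diagonal_smul, map_smul, map_smul, ha.1]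
      · rw [diagonal_smul, map_smul, map_smul, ha.2]
  -- The coefficient is dominated in norm by the operator, so it passes to limits.
  obtain ⟨y, hy, hlim⟩ := mem_closure_iff_seq_limit.1 (mem_closure_monomialSpan α π hx)
  choose a ha using fun n => hspan (y n) (hy n)
  have hcauchy : CauchySeq a := by
    rw [Metric.cauchySeq_iff']
    intro ε hε
    obtain ⟨N, hN⟩ := Metric.cauchySeq_iff'.1 hlim.cauchySeq ε hε
    refine ⟨N, fun n hn => lt_of_le_of_lt ?_ (hN n hn)⟩
    rw [dist_eq_norm, dist_eq_norm]
    exact hnorm (hsub (ha n) (ha N))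
  obtain ⟨b, hb⟩ := cauchySeq_tendsto_of_complete hcauchy
  have hdiag : Filter.Tendsto (fun n => diagonal α π (a n)) Filter.atTop
      (nhds (diagonal α π b)) := ((diagonalCLM α π).continuous.tendsto b).comp hb
  refine ⟨b, fun t => ?_, ?_⟩
  · rw [← compression_diagonal]
    refine tendsto_nhds_unique (((compression t).continuous.tendsto x).comp hlim) ?_
    refine (((compression t).continuous.tendsto _).comp hdiag).congr fun n => ?_
    exact ((ha n).1 t).symm
  · refine tendsto_nhds_unique ((φ.continuous.tendsto x).comp hlim) ?_
    exact ((φ.continuous.tendsto _).comp hdiag).congr fun n => (ha n).2.symm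

/-- An element with positive image under a faithful representation is of the form `b⋆ b`. -/
theorem exists_eq_star_mul_self_of_map_nonneg {π : A →⋆ₐ[ℂ] (H →L[ℂ] H)}
    (hπ : Function.Injective π) {a : A} (ha : 0 ≤ π a) : ∃ b, a = star b * b := by
  have hsa : IsSelfAdjoint a := hπ (by rw [map_star]; exact (IsSelfAdjoint.of_nonneg ha).star_eq)
  have hcont : Continuous π := by
    refine AddMonoidHomClass.continuous_of_bound π 1 fun x => ?_
    rw [one_mul]
    exact NonUnitalStarAlgHom.norm_apply_le π x
  -- Injectivity of `π` reduces the claim to the square root of the positive operator `π a`,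
  -- so positivity of `a` itself is not needed.
  refine ⟨cfc Real.sqrt a, hπ ?_⟩
  have hb : IsSelfAdjoint (cfc Real.sqrt a) := cfc_predicate _ _
  have hmap : π (cfc Real.sqrt a) = cfc Real.sqrt (π a) :=
    StarAlgHomClass.map_cfc π Real.sqrt a (hf := by fun_prop) (hφ := hcont)
  rw [hb.star_eq, map_mul, hmap, ← cfc_mul Real.sqrt Real.sqrt (π a)]
  conv_lhs => rw [← cfc_id' ℝ (π a)]
  refine cfc_congr fun r hr => ?_
  exact (Real.mul_self_sqrt (spectrum_nonneg_of_nonneg ha hr)).symm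

/-- A positive functional which factors through the canonical expectation, and which is faithful
on `A`, is faithful on the reduced crossed product. -/
theorem eq_zero_of_apply_star_mul_self_eq_zero {α : Γ →* (A ≃⋆ₐ[ℂ] A)}
    {π : A →⋆ₐ[ℂ] (H →L[ℂ] H)} (hπ : Function.Injective π)
    {φ : (L2 Γ H →L[ℂ] L2 Γ H) →L[ℂ] ℂ}
    (hφ : ∀ (a : A) (s : Γ), s ≠ 1 →
      φ (diagonal α π a * (leftTranslation Γ H s : L2 Γ H →L[ℂ] L2 Γ H)) = 0)
    (hfaith : ∀ a : A, φ (diagonal α π (star a * a)) = 0 → a = 0)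
    {x : L2 Γ H →L[ℂ] L2 Γ H} (hx : x ∈ reducedCrossedProduct α π)
    (h0 : φ (star x * x) = 0) : x = 0 := by
  obtain ⟨a, ha, hφa⟩ := exists_coefficient α π hπ hφ (mul_mem (star_mem hx) hx)
  have hpos : 0 ≤ π a := by
    have := compression_star_mul_self_nonneg 1 x
    rwa [ha 1, inv_one, map_one, StarAlgEquiv.one_apply] at this
  obtain ⟨b, rfl⟩ := exists_eq_star_mul_self_of_map_nonneg hπ hpos
  have hb : b = 0 := hfaith b (hφa ▸ h0)
  refine eq_zero_of_compression_eq_zero fun t => ?_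
  rw [ha t, hb, mul_zero, map_zero, map_zero]

end CrossedProduct

/-! ### Ideals of intermediate algebras -/

section Ideals

variable {M : Type*} [CStarAlgebra M] {C : StarSubalgebra ℂ M} {B : StarSubalgebra ℂ C}

/-- A two-sided ideal of a subalgebra `B ⊆ C ⊆ M`, as a linear subspace of `M`. -/
def idealSubmodule (I : TwoSidedIdeal B) : Submodule ℂ M where
  carrier := (fun b : B => ((b : C) : M)) '' I
  zero_mem' := ⟨0, I.zero_mem, rfl⟩
  add_mem' := by
    rintro _ _ ⟨a, ha, rfl⟩ ⟨b, hb, rfl⟩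
    exact ⟨a + b, I.add_mem ha hb, rfl⟩
  smul_mem' := by
    rintro c _ ⟨a, ha, rfl⟩
    refine ⟨c • a, ?_, rfl⟩
    rw [← one_mul a, ← smul_mul_assoc]
    exact I.mul_mem_left _ _ ha

theorem mem_idealSubmodule {I : TwoSidedIdeal B} {x : M} :
    x ∈ idealSubmodule I ↔ ∃ b ∈ I, ((b : C) : M) = x := Iff.rfl

theorem isClosedEmbedding_coe_coe (hC : IsClosed (C : Set M)) (hB : IsClosed (B : Set C)) :
    Topology.IsClosedEmbedding fun b : B => ((b : C) : M) :=
  hC.isClosedEmbedding_subtypeVal.comp hB.isClosedEmbedding_subtypeVal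

/-- The elements of a proper ideal have distance at least `1` from the unit, by the Neumann
series. -/
theorem one_le_norm_one_sub_of_mem_idealSubmodule (hC : IsClosed (C : Set M))
    (hB : IsClosed (B : Set C)) {I : TwoSidedIdeal B} (hI : I ≠ ⊤) {x : M}
    (hx : x ∈ idealSubmodule I) : 1 ≤ ‖1 - x‖ := by
  obtain ⟨b, hb, rfl⟩ := hx
  by_contra! hlt
  have hsum := (summable_geometric_of_norm_lt_one hlt).hasSum
  have hmem : (∑' n : ℕ, (1 - ((b : C) : M)) ^ n) ∈ Set.range fun b : B => ((b : C) : M) :=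
    (isClosedEmbedding_coe_coe hC hB).isClosed_range.mem_of_tendsto hsum <|
      Filter.Eventually.of_forall fun F => ⟨∑ n ∈ F, (1 - b) ^ n, by simp⟩
  obtain ⟨c, hc⟩ := hmem
  refine hI (I.one_mem_iff.1 ?_)
  have hbc : b * c = 1 := by
    refine Subtype.ext (Subtype.ext ?_)
    change ((b : C) : M) * ((c : C) : M) = 1
    change ((c : C) : M) = _ at hc
    have := mul_neg_geom_series (1 - ((b : C) : M)) hlt
    rwa [sub_sub_cancel, ← hc] at this
  rw [← hbc]
  exact I.mul_mem_right _ _ hb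

end Ideals

end GammaCStar

end

theorem theorem1p1 {Γ A H : Type*} [Group Γ] [Countable Γ]
    (hΓ : GammaCStar.IsCStarSimpleGroup Γ)
    [CStarAlgebra A] (α : Γ →* (A ≃⋆ₐ[ℂ] A))
    [NormedAddCommGroup H] [InnerProductSpace ℂ H] [CompleteSpace H]
    (π : A →⋆ₐ[ℂ] (H →L[ℂ] H)) (hπ : Function.Injective π)
    (hμ : ∃ μ : PMF Γ, GammaCStar.IsCStarSimpleMeasure μ ∧
      ∀ τ : A →ₗ[ℂ] ℂ, GammaCStar.IsState τ → GammaCStar.IsStationary α μ τ →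
        GammaCStar.IsFaithful τ)
    (B : StarSubalgebra ℂ (GammaCStar.reducedCrossedProduct α π))
    (hBclosed : IsClosed (B : Set (GammaCStar.reducedCrossedProduct α π)))
    (hBinv : ∀ s : Γ, ∀ x ∈ B, GammaCStar.crossedProductAction α π s x ∈ B) :
    GammaCStar.IsGammaSimple
      (GammaCStar.restrictAction (GammaCStar.crossedProductAction α π) B hBinv) := by
  open GammaCStar in
  obtain ⟨μ, hsimple, hfaith⟩ := hμ
  intro I hIc hIinv
  refine or_iff_not_imp_right.2 fun hI => ?_
  have hC : IsClosed (reducedCrossedProduct α π : Set (L2 Γ H →L[ℂ] L2 Γ H)) :=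
    StarSubalgebra.isClosed_topologicalClosure _
  obtain ⟨φ, hφ, hφ1, hinv, hvan⟩ := exists_invariant_functional_vanishing
    (leftTranslation Γ H) μ (J := idealSubmodule I)
    ((isClosedEmbedding_coe_coe hC hBclosed).isClosedMap _ hIc)
    (by
      rintro s _ ⟨b, hb, rfl⟩
      exact ⟨_, hIinv s b hb, rfl⟩)
    fun x hx => one_le_norm_one_sub_of_mem_idealSubmodule hC hBclosed hI hx
  have hstate : IsState (φ.comp (diagonalCLM α π)).toLinearMap := by
    refine ⟨fun a => ?_, ?_⟩
    · change 0 ≤ φ (diagonal α π (star a * a))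
      rw [diagonal_mul, diagonal_star]
      exact apply_star_mul_self_nonneg hφ hφ1 _
    · change φ (diagonal α π 1) = 1
      rw [diagonal_one, hφ1]
  have hstat : IsStationary α μ (φ.comp (diagonalCLM α π)).toLinearMap := fun a => by
    have := hasSum_apply_of_markov_invariant hinv (diagonal α π a)
    simp only [innerAction_diagonal] at this
    exact this
  refine TwoSidedIdeal.ext fun b => ⟨fun hb => ?_, fun hb => ?_⟩
  · have hz : ((b : reducedCrossedProduct α π) : L2 Γ H →L[ℂ] L2 Γ H) = 0 :=
      eq_zero_of_apply_star_mul_self_eq_zero hπ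
        (fun a s hs => apply_diagonal_mul_leftTranslation_eq_zero hsimple α π hφ hinv a hs)
        (hfaith _ hstate hstat) (b : reducedCrossedProduct α π).2
        (hvan _ ⟨star b * b, I.mul_mem_left _ _ hb, rfl⟩)
    exact (TwoSidedIdeal.mem_bot _).2 (Subtype.ext (Subtype.ext hz))
  · rw [(TwoSidedIdeal.mem_bot _).1 hb]
    exact I.zero_mem
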